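/- Let $\mathcal{H}$ be a finite-dimensional complex Hilbert space, let $B, C$ be Hermitian operators on $\mathcal{H}$, and let $P_0$ be an orthogonal projector with $[B,P_0]=[C,P_0]=0$. Consider the controlled Schrödinger equation $$\frac{d}{dt}\psi(t) = -i\,\bigl(s(t)B+(1-s(t))C\bigr)\psi(t),\qquad \psi(0)=\psi_0,\qquad t\in[0,t_f],$$ where the schedule $s$ is a measurable function on $[0,t_f]$ with values in $[0,1]$, and where a solution is an absolutely continuous function that satisfies the equation for almost every $t$. A vector $\psi_1$ is reachable (in finite time) from $\psi_0$ if for some $t_f\in[0,\infty)$ and some schedule $s$ on $[0,t_f]$ there is a solution with $\psi(0)=\psi_0$ and $\psi(t_f)=\psi_1$. Let $\hat{\mathfrak{L}}$ be the real Lie algebra of operators generated by $-iB$ and $-iC$ under the commutator, and let $d_0=\dim \mathrm{Ran}(P_0)$. Then: 1. $\mathcal{H}=\mathrm{Ran}(P_0)\oplus\mathrm{Ker}(P_0)$, and the two subspaces are orthogonal. 2. Every element of $\hat{\mathfrak{L}}$ maps $\mathrm{Ran}(P_0)$ into itself and $\mathrm{Ker}(P_0)$ into itself. 3. Suppose that the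 algebra of the restrictions to $\mathrm{Ran}(P_0)$ of the elements of $\hat{\mathfrak{L}}$ contains $su(d_0)$, the algebra of all traceless skew-Hermitian operators of $\mathrm{Ran}(P_0)$ (in particular, this holds if $\hat{\mathfrak{L}}=su(d_0)\oplus\hat{\mathfrak{L}}_1$ with respect to the block structure, for some $\hat{\mathfrak{L}}_1$). Then for all unit vectors $\psi_0,\psi_1\in\mathrm{Ran}(P_0)$ the state $\psi_1$ is reachable from $\psi_0$, that is, $c\,\psi_1$ is reachable from $\psi_0$ for some $c\in\mathbb{C}$ with $|c|=1$. If $d_0\ge 2$, then the vector $\psi_1$ itself is reachable from $\psi_0$. -/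

import Mathlib

open Set MeasureTheory

attribute [local instance 100] LieRing.ofAssociativeRing

noncomputable section

/-- The Hamiltonian `s B + (1 - s) C` for the value `s` of the schedule. -/
def scheduleHamiltonian {H : Type*} [NormedAddCommGroup H] [InnerProductSpace ℂ H]
    (B C : Module.End ℂ H) (s : ℝ) : Module.End ℂ H :=
  (s : ℂ) • B + ((1 - s : ℝ) : ℂ) • C

/-- `ψ` solves the Schrödinger equation `ψ' = -i (s(t) B + (1 - s(t)) C) ψ` on `[0, T]`
in the sense of Carathéodory: it is absolutely continuous and the equation holds at almost every
time. -/
def IsSchrodingerSolution {H : Type*} [NormedAddCommGroup H] [InnerProductSpace ℂ H]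
    (B C : Module.End ℂ H) (s : ℝ → ℝ) (T : ℝ) (ψ : ℝ → H) : Prop :=
  AbsolutelyContinuousOnInterval ψ 0 T ∧
    ∀ᵐ t : ℝ, t ∈ Icc 0 T →
      HasDerivAt ψ ((-Complex.I) • scheduleHamiltonian B C (s t) (ψ t)) t

/-- A schedule on the control interval `[0, T]`: a measurable function with values in `[0, 1]`. -/
def IsSchedule (s : ℝ → ℝ) (T : ℝ) : Prop :=
  Measurable s ∧ ∀ t ∈ Icc 0 T, s t ∈ Icc (0 : ℝ) 1

/-- `ψ₁` can be reached from `ψ₀` in some finite time, by some schedule. -/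
def IsReachable {H : Type*} [NormedAddCommGroup H] [InnerProductSpace ℂ H]
    (B C : Module.End ℂ H) (ψ₀ ψ₁ : H) : Prop :=
  ∃ (T : ℝ) (s : ℝ → ℝ) (ψ : ℝ → H), 0 ≤ T ∧ IsSchedule s T ∧
    IsSchrodingerSolution B C s T ψ ∧ ψ 0 = ψ₀ ∧ ψ T = ψ₁

/-- The dynamical Lie algebra generated by the Hamiltonians `B` and `C`: the smallest real Lie
algebra of operators, under the commutator, that contains `-iB` and `-iC`. -/
def dynamicalLieAlgebra {H : Type*} [NormedAddCommGroup H] [InnerProductSpace ℂ H]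
    (B C : Module.End ℂ H) : LieSubalgebra ℝ (Module.End ℂ H) :=
  LieSubalgebra.lieSpan ℝ (Module.End ℂ H) {(-Complex.I) • B, (-Complex.I) • C}

/-- The real Lie algebra `su(V)` of traceless skew-adjoint operators of `V`. -/
def suAlgebra (V : Type*) [NormedAddCommGroup V] [InnerProductSpace ℂ V] :
    LieSubalgebra ℝ (Module.End ℂ V) where
  carrier := {A | (∀ x y : V, inner ℂ (A x) y = -inner ℂ x (A y)) ∧ LinearMap.trace ℂ V A = 0}
  zero_mem' := by simp
  add_mem' := by
    rintro A A' ⟨h, ht⟩ ⟨h', ht'⟩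
    refine ⟨fun x y => ?_, by simp [ht, ht']⟩
    simp only [LinearMap.add_apply, inner_add_left, inner_add_right, h, h']
    ring
  smul_mem' := by
    rintro r A ⟨h, ht⟩
    have e : r • A = (r : ℂ) • A := by
      ext x
      simp
    refine ⟨fun x y => ?_, by rw [e, map_smul, ht, smul_zero]⟩
    rw [e]
    simp [h]
  lie_mem' := by
    rintro A A' ⟨h, -⟩ ⟨h', -⟩
    refine ⟨fun x y => ?_, ?_⟩
    · simp only [Ring.lie_def, LinearMap.sub_apply, Module.End.mul_apply, inner_sub_left,
        inner_sub_right, h, h']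
      ring
    · rw [Ring.lie_def, map_sub, LinearMap.trace_mul_comm, sub_self]

/-- The block of `L` on the subspace `K`: all operators of `K` that are the restriction to `K` of
some element of `L`. -/
def blockRestriction {H : Type*} [NormedAddCommGroup H] [InnerProductSpace ℂ H]
    (L : LieSubalgebra ℝ (Module.End ℂ H)) (K : Submodule ℂ H) : Set (Module.End ℂ K) :=
  {A | ∃ X ∈ L, ∀ x : K, X (x : H) = (A x : H)}

end

open NormedSpace Filter Topology

/-! The commutant of `P₀` is a Lie algebra containing `-iB` and `-iC`, which gives the block
structure. Reachability is a controllability argument on `K = Ran P₀`, using only the schedules with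
values 1 and 0, whose flows generate a monoid of unitaries of `K`.

Backward flows are not available, so accessibility comes first. Among the direction spaces realised
by maps into the cone over the forward orbit, take those of maximal dimension. One more flow cannot
enlarge them (`IsAccessible.step`), so their intersection contains the generators and is stable
under backward conjugation; differentiating, it is stable under commutators and contains the
generated Lie algebra, hence `su` (`exists_isAccessible_ge_invariant`). If `dim K ≥ 2`, the real
scalars and `su` move a nonzero vector in all directions, so the forward orbit of a unit vector
contains an open piece of the sphere (`exists_forward_orbit_mem_nhds`).

Poincaré recurrence replaces the missing inverses: it carries this open piece back to the starting
point. Reachability is then locally full and symmetric, and connectedness of the sphere gives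
transitivity. In dimension one, unit vectors differ by a phase and time zero suffices. -/

/-- The monoid of operators generated by the forward flows `exp (t X)`, `t ≥ 0`, of the
generators `X ∈ G`. -/
def flowMonoid {V : Type*} [NormedAddCommGroup V] [InnerProductSpace ℂ V]
    (G : Set (V →L[ℂ] V)) : Submonoid (V →L[ℂ] V) :=
  Submonoid.closure {g | ∃ X ∈ G, ∃ t : ℝ, 0 ≤ t ∧ g = exp (t • X)}

theorem exp_neg_mul_exp_self {A : Type*} [NormedRing A] [NormedAlgebra ℝ A] [CompleteSpace A]
    (X : A) : exp (-X) * exp X = 1 := by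
  let _ : NormedAlgebra ℚ A := NormedAlgebra.restrictScalars ℚ ℝ A
  rw [← exp_add_of_commute (Commute.refl _).neg_left]; simp

theorem exp_mul_exp_neg_self {A : Type*} [NormedRing A] [NormedAlgebra ℝ A] [CompleteSpace A]
    (X : A) : exp X * exp (-X) = 1 := by
  let _ : NormedAlgebra ℚ A := NormedAlgebra.restrictScalars ℚ ℝ A
  rw [← exp_add_of_commute (Commute.refl _).neg_right]; simp

/-- Conjugation by `exp (t X)` as a real-linear automorphism of a Banach algebra. -/
noncomputable def conjExp {A : Type*} [NormedRing A] [NormedAlgebra ℝ A] [CompleteSpace A]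
    (X : A) (t : ℝ) : A ≃ₗ[ℝ] A where
  toFun w := exp (t • X) * w * exp (-(t • X))
  invFun w := exp (-(t • X)) * w * exp (t • X)
  map_add' := by intros; noncomm_ring
  map_smul' := by intros; simp
  left_inv w := by
    have h := exp_neg_mul_exp_self (t • X)
    calc _ = (exp (-(t • X)) * exp (t • X)) * w * (exp (-(t • X)) * exp (t • X)) := by noncomm_ring
      _ = w := by rw [h]; simp
  right_inv w := by
    have h := exp_mul_exp_neg_self (t • X)
    calc _ = (exp (t • X) * exp (-(t • X))) * w * (exp (t • X) * exp (-(t • X))) := by noncomm_ring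
      _ = w := by rw [h]; simp

/-! ### Conjugation by exponentials and its derivative -/

section BanachAlgebra

variable {A : Type*} [NormedRing A] [NormedAlgebra ℝ A] [CompleteSpace A]

theorem conjExp_apply (X : A) (t : ℝ) (w : A) :
    conjExp X t w = exp (t • X) * w * exp (-(t • X)) := rfl

theorem conjExp_symm_apply (X : A) (t : ℝ) (w : A) :
    (conjExp X t).symm w = exp (-(t • X)) * w * exp (t • X) := rfl

theorem conjExp_symm_of_commute {X w : A} (h : Commute X w) (t : ℝ) :
    (conjExp X t).symm w = w := by
  rw [conjExp_symm_apply, mul_assoc, ← ((h.smul_left t).exp_left).eq, ← mul_assoc,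
    exp_neg_mul_exp_self, one_mul]

theorem conjExp_of_commute {X w : A} (h : Commute X w) (t : ℝ) : conjExp X t w = w := by
  rw [LinearEquiv.eq_symm_apply (conjExp X t) |>.mp (conjExp_symm_of_commute h t).symm]

/-- A closed subspace that contains the orbit of `w` under the backward conjugations by `exp (t X)`
contains the commutator of `X` and `w`. -/
theorem lie_mem_of_conjExp_symm_mem {W : Submodule ℝ A} (hW : IsClosed (W : Set A)) {X w : A}
    (h : ∀ t : ℝ, 0 < t → (conjExp X t).symm w ∈ W) (hw : w ∈ W) : X * w - w * X ∈ W := by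
  have h1 : HasDerivAt (fun t : ℝ => exp (t • (-X)) * w * exp (t • X)) (-X * w + w * X) 0 := by
    have := ((hasDerivAt_exp_smul_const (-X) (0 : ℝ)).mul_const w).fun_mul
      (hasDerivAt_exp_smul_const X (0 : ℝ))
    simpa using this
  -- Only positive times are available, so the derivative is taken as a right-hand limit.
  have h2 : Tendsto (slope (fun t : ℝ => exp (t • (-X)) * w * exp (t • X)) 0) (𝓝[>] 0)
      (𝓝 (-X * w + w * X)) :=
    (hasDerivAt_iff_tendsto_slope.mp h1).mono_left (nhdsWithin_mono _ (by intro t ht; exact ne_of_gt ht))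
  have h3 : -X * w + w * X ∈ W := by
    refine hW.mem_of_tendsto h2 ?_
    filter_upwards [self_mem_nhdsWithin] with t ht
    rw [slope_def_module]
    refine W.smul_mem _ (W.sub_mem ?_ ?_)
    · simpa [conjExp_symm_apply] using h t ht
    · simpa using hw
  have := W.neg_mem h3
  convert this using 1
  noncomm_ring

end BanachAlgebra

/-! ### Directions covered by the forward cone -/

section Accessibility

variable {V : Type*} [NormedAddCommGroup V] [InnerProductSpace ℂ V]

/-- `φ` is the value at the origin of a map into the cone over the forward orbit of `ψ` whose
derivative covers the directions `A φ` with `A ∈ D`. -/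
def IsAccessible (G : Set (V →L[ℂ] V)) (ψ : V) (D : Submodule ℝ (V →L[ℂ] V)) (φ : V) : Prop :=
  ∃ (E : Type) (_ : NormedAddCommGroup E) (_ : NormedSpace ℝ E) (_ : CompleteSpace E)
    (F : E → V) (F' : E →L[ℝ] V), HasStrictFDerivAt F F' 0 ∧ F 0 = φ ∧
      (∀ A ∈ D, ∃ e, F' e = A φ) ∧
      ∀ᶠ e in 𝓝 0, ∃ r : ℝ, 0 < r ∧ ∃ g ∈ flowMonoid G, F e = r • g ψ

theorem exp_mem_flowMonoid {G : Set (V →L[ℂ] V)} {X : V →L[ℂ] V} (hX : X ∈ G) {t : ℝ}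
    (ht : 0 ≤ t) : exp (t • X) ∈ flowMonoid G :=
  Submonoid.subset_closure ⟨X, hX, t, ht, rfl⟩

/-- The map `r ↦ (1 + r) ψ` covers the radial direction; this is why the cone replaces the orbit. -/
theorem isAccessible_span_one (G : Set (V →L[ℂ] V)) (ψ : V) :
    IsAccessible G ψ (Submodule.span ℝ {1}) ψ := by
  refine ⟨ℝ, inferInstance, inferInstance, inferInstance, fun r => (1 + r) • ψ,
    (ContinuousLinearMap.id ℝ ℝ).smulRight ψ, ?_, by simp, ?_, ?_⟩
  · exact ((hasStrictFDerivAt_id (0 : ℝ)).const_add 1).smul_const ψ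
  · intro A hA
    obtain ⟨c, rfl⟩ := Submodule.mem_span_singleton.mp hA
    exact ⟨c, by simp⟩
  · filter_upwards [lt_mem_nhds (show (-1 : ℝ) < 0 by norm_num)] with r hr
    exact ⟨1 + r, by linarith, 1, one_mem _, by simp⟩

variable [CompleteSpace V]

/-- Extend `F` to `(e, u) ↦ exp ((t + u) X) (F e)`. Varying `e` gives the conjugated old directions,
varying `u` gives `X`. Strict positivity of `t` keeps `t + u` admissible for small `u` of either
sign. -/
theorem IsAccessible.step {G : Set (V →L[ℂ] V)} {ψ φ : V} {D : Submodule ℝ (V →L[ℂ] V)}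
    (h : IsAccessible G ψ D φ) {X : V →L[ℂ] V} (hX : X ∈ G) {t : ℝ} (ht : 0 < t) :
    IsAccessible G ψ (D.map (conjExp X t : (V →L[ℂ] V) →ₗ[ℝ] (V →L[ℂ] V)) ⊔ Submodule.span ℝ {X})
      (exp (t • X) φ) := by
  obtain ⟨E, _, _, _, F, F', hF, hF0, hD, hS⟩ := h
  have h1 : HasStrictFDerivAt (fun p : E × ℝ => exp ((t + p.2) • X))
      ((ContinuousLinearMap.snd ℝ E ℝ).smulRight (X * exp (t • X))) 0 := by
    have a1 : HasStrictDerivAt (fun u : ℝ => exp (u • X)) (X * exp (t • X)) (t + (0 : E × ℝ).2) := by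
      simpa using hasStrictDerivAt_exp_smul_const' (𝕂 := ℝ) X t
    have a2 : HasStrictFDerivAt (fun p : E × ℝ => t + p.2) (ContinuousLinearMap.snd ℝ E ℝ) 0 :=
      (ContinuousLinearMap.snd ℝ E ℝ).hasStrictFDerivAt.const_add t
    refine HasStrictFDerivAt.congr_fderiv
      (HasStrictFDerivAt.comp (g := fun u : ℝ => exp (u • X)) (0 : E × ℝ) a1.hasStrictFDerivAt a2) ?_
    ext <;> simp
  have h2 : HasStrictFDerivAt (fun p : E × ℝ => F p.1) (F'.comp (ContinuousLinearMap.fst ℝ E ℝ)) 0 :=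
    HasStrictFDerivAt.comp (0 : E × ℝ) (g := F) hF (ContinuousLinearMap.fst ℝ E ℝ).hasStrictFDerivAt
  let R := ContinuousLinearMap.restrictScalarsL ℂ V V ℝ ℝ
  have h1' : HasStrictFDerivAt (fun p : E × ℝ => (R (exp ((t + p.2) • X)) : V →L[ℝ] V))
      (R.comp ((ContinuousLinearMap.snd ℝ E ℝ).smulRight (X * exp (t • X)))) 0 :=
    R.hasStrictFDerivAt.comp (0 : E × ℝ) h1
  have h3 := h1'.clm_apply h2
  refine ⟨E × ℝ, inferInstance, inferInstance, inferInstance, _, _, h3, ?_, ?_, ?_⟩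
  · simp [R, hF0]
  · intro A hA
    obtain ⟨A1, ⟨A0, hA0, rfl⟩, A2, hA2, rfl⟩ := Submodule.mem_sup.mp hA
    obtain ⟨c, rfl⟩ := Submodule.mem_span_singleton.mp hA2
    obtain ⟨e, he⟩ := hD A0 hA0
    refine ⟨(e, c), ?_⟩
    have k : exp (-(t • X)) (exp (t • X) φ) = φ := by
      have := congrArg (fun T : V →L[ℂ] V => T φ) (exp_neg_mul_exp_self (t • X))
      simpa using this
    simp [R, hF0, he, conjExp_apply, k]
  · have c1 : Tendsto (fun p : E × ℝ => p.1) (𝓝 0) (𝓝 0) := continuous_fst.tendsto' _ _ rfl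
    have c2 : Tendsto (fun p : E × ℝ => p.2) (𝓝 0) (𝓝 0) := continuous_snd.tendsto' _ _ rfl
    filter_upwards [c1.eventually hS, c2.eventually (lt_mem_nhds (neg_lt_zero.mpr ht))]
      with p ⟨r, hr, g, hg, hp⟩ hp2
    refine ⟨r, hr, exp ((t + p.2) • X) * g,
      mul_mem (exp_mem_flowMonoid hX (by linarith)) hg, ?_⟩
    simp [R, hp]

end Accessibility

/-- The flows of skew-adjoint generators preserve the norm. -/
theorem norm_flowMonoid_apply {V : Type*} [NormedAddCommGroup V] [InnerProductSpace ℂ V]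
    [CompleteSpace V] {G : Set (V →L[ℂ] V)} (hG : ∀ X ∈ G, star X = -X)
    {g : V →L[ℂ] V} (hg : g ∈ flowMonoid G) (x : V) : ‖g x‖ = ‖x‖ := by
  have : flowMonoid G ≤ unitary (V →L[ℂ] V) := by
    refine Submonoid.closure_le.mpr ?_
    rintro _ ⟨X, hX, t, -, rfl⟩
    let _ : NormedAlgebra ℚ (V →L[ℂ] V) := NormedAlgebra.restrictScalars ℚ ℝ _
    refine exp_mem_unitary_of_mem_skewAdjoint ?_
    rw [skewAdjoint.mem_iff, star_smul, hG X hX, smul_neg, star_trivial]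
  exact ContinuousLinearMap.norm_map_of_mem_unitary (this hg) x

/-! ### Transitivity of the forward flows on the unit sphere -/

section Transitivity

variable {V : Type*} [NormedAddCommGroup V] [InnerProductSpace ℂ V] [FiniteDimensional ℂ V]

theorem finiteDimensional_real_endomorphism : FiniteDimensional ℝ (V →L[ℂ] V) :=
  Module.Finite.trans ℂ (V →L[ℂ] V)

/-- There is a direction space of an accessible point that contains the identity and every subspace
generated by `G` under the adjoint action: it contains a subspace `W` with `G ⊆ W` and `[G, W] ⊆ W`. -/
theorem exists_isAccessible_ge_invariant (G : Set (V →L[ℂ] V)) (ψ : V) :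
    ∃ (D W : Submodule ℝ (V →L[ℂ] V)) (φ : V), IsAccessible G ψ D φ ∧ W ≤ D ∧ 1 ∈ W ∧ G ⊆ W ∧
      ∀ X ∈ G, ∀ w ∈ W, X * w - w * X ∈ W := by
  have : FiniteDimensional ℝ (V →L[ℂ] V) := finiteDimensional_real_endomorphism
  have := FiniteDimensional.complete ℂ V
  let 𝒟 : Set (Submodule ℝ (V →L[ℂ] V)) := {D | 1 ∈ D ∧ ∃ φ, IsAccessible G ψ D φ}
  have hne : ∃ n, ∃ D ∈ 𝒟, Module.finrank ℝ D = n :=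
    ⟨_, _, ⟨Submodule.mem_span_singleton_self 1, ψ, isAccessible_span_one G ψ⟩, rfl⟩
  obtain ⟨n, ⟨D, hD, hDn⟩, hmax⟩ : ∃ n, (∃ D ∈ 𝒟, Module.finrank ℝ D = n) ∧
      ∀ D ∈ 𝒟, Module.finrank ℝ D ≤ n := by
    classical
    have hb : ∀ m, (∃ D ∈ 𝒟, Module.finrank ℝ D = m) → m ≤ Module.finrank ℝ (V →L[ℂ] V) := by
      rintro _ ⟨D, -, rfl⟩
      exact D.finrank_le
    obtain ⟨n₀, h₀⟩ := hne
    exact ⟨_, Nat.findGreatest_spec (P := fun m => ∃ D ∈ 𝒟, Module.finrank ℝ D = m) (hb _ h₀) h₀,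
      fun D hD => Nat.le_findGreatest (hb _ ⟨D, hD, rfl⟩) ⟨D, hD, rfl⟩⟩
  let ℳ : Set (Submodule ℝ (V →L[ℂ] V)) := {D | D ∈ 𝒟 ∧ Module.finrank ℝ D = n}
  -- Maximality forces `X` into the conjugate of `D`; as `X` is fixed by the conjugation, it lies in
  -- `D` as well.
  have key : ∀ D ∈ ℳ, ∀ X ∈ G, ∀ t : ℝ, 0 < t →
      X ∈ D ∧ D.map (conjExp X t : (V →L[ℂ] V) →ₗ[ℝ] (V →L[ℂ] V)) ∈ ℳ := by
    rintro D ⟨⟨h1, φ, hφ⟩, hn⟩ X hX t ht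
    have hacc := hφ.step hX ht
    set D' := D.map (conjExp X t : (V →L[ℂ] V) →ₗ[ℝ] (V →L[ℂ] V)) with hD'
    have hr : Module.finrank ℝ D' = n := by
      rw [← hn]; exact LinearEquiv.finrank_map_eq (conjExp X t) D
    have h1' : (1 : V →L[ℂ] V) ∈ D' := ⟨1, h1, conjExp_of_commute (Commute.one_right X) t⟩
    have heq : D' = D' ⊔ Submodule.span ℝ {X} :=
      Submodule.eq_of_le_of_finrank_le le_sup_left
        (hr ▸ hmax _ ⟨Submodule.mem_sup_left h1', _, hacc⟩)
    have hXD' : X ∈ D' :=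
      heq ▸ Submodule.mem_sup_right (Submodule.mem_span_singleton_self X)
    rw [← heq] at hacc
    refine ⟨?_, ⟨h1', _, hacc⟩, hr⟩
    obtain ⟨w, hw, hwX⟩ := hXD'
    have : w = X := by
      have e : conjExp X t w = X := hwX
      rw [← LinearEquiv.eq_symm_apply] at e
      rw [e, conjExp_symm_of_commute (Commute.refl X)]
    exact this ▸ hw
  obtain ⟨h1, φ, hφ⟩ := hD
  have hDM : D ∈ ℳ := ⟨⟨h1, φ, hφ⟩, hDn⟩
  -- Conjugation permits a change of maximal space, so a single `D` need not be stable; the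
  -- intersection is.
  refine ⟨D, sInf ℳ, φ, hφ, sInf_le hDM, ?_, ?_, ?_⟩
  · exact Submodule.mem_sInf.mpr fun D hD => hD.1.1
  · exact fun X hX => Submodule.mem_sInf.mpr fun D hD => (key D hD X hX 1 one_pos).1
  · intro X hX w hw
    refine lie_mem_of_conjExp_symm_mem (Submodule.closed_of_finiteDimensional _) ?_ hw
    intro t ht
    refine Submodule.mem_sInf.mpr fun D hD => ?_
    obtain ⟨v, hv, hvw⟩ := Submodule.mem_sInf.mp hw _ (key D hD X hX t ht).2
    have e : conjExp X t v = w := hvw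
    rw [← LinearEquiv.eq_symm_apply] at e
    exact e ▸ hv

/-- A subspace that contains a set and is stable under commutation with it contains the Lie algebra
generated by the set. -/
theorem lieSpan_le_of_lie_mem {A : Type*} [Ring A] [Algebra ℝ A] {s : Set A} {W : Submodule ℝ A}
    (hs : s ⊆ W) (h : ∀ X ∈ s, ∀ w ∈ W, ⁅X, w⁆ ∈ W) :
    ∀ X ∈ LieSubalgebra.lieSpan ℝ A s, X ∈ W := by
  -- The induction must also carry that `X` normalises `W`; the Jacobi identity then handles
  -- brackets.
  suffices ∀ X ∈ LieSubalgebra.lieSpan ℝ A s, X ∈ W ∧ ∀ w ∈ W, ⁅X, w⁆ ∈ W from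
    fun X hX => (this X hX).1
  intro X hX
  induction hX using LieSubalgebra.lieSpan_induction with
  | mem X hX => exact ⟨hs hX, h X hX⟩
  | zero => exact ⟨W.zero_mem, fun w _ => by simp⟩
  | add X Y _ _ hX hY =>
    exact ⟨W.add_mem hX.1 hY.1, fun w hw => by rw [add_lie]; exact W.add_mem (hX.2 w hw) (hY.2 w hw)⟩
  | smul c X _ hX =>
    exact ⟨W.smul_mem c hX.1, fun w hw => by rw [smul_lie]; exact W.smul_mem c (hX.2 w hw)⟩
  | lie X Y _ _ hX hY =>
    refine ⟨hX.2 Y hY.1, fun w hw => ?_⟩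
    rw [lie_lie]
    exact W.sub_mem (hX.2 _ (hY.2 w hw)) (hY.2 _ (hX.2 w hw))

/-- In dimension at least two, the real multiples of the identity and `su(V)` act transitively on
directions: every vector is of the form `c φ + A φ`. -/
theorem exists_mem_suAlgebra_apply_eq (hd : 2 ≤ Module.finrank ℂ V) {φ : V} (hφ : φ ≠ 0) (v : V) :
    ∃ (c : ℝ) (A : Module.End ℂ V), A ∈ suAlgebra V ∧ c • φ + A φ = v := by
  wlog hn : ‖φ‖ = 1 generalizing φ
  · have h0 : ‖φ‖ ≠ 0 := norm_ne_zero_iff.mpr hφ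
    have h0' : (‖φ‖ : ℂ) ≠ 0 := by exact_mod_cast h0
    obtain ⟨c, A, hA, h⟩ := this (φ := (‖φ‖⁻¹ : ℝ) • φ) (smul_ne_zero (inv_ne_zero h0) hφ)
      (by rw [norm_smul]; simp [h0])
    refine ⟨‖φ‖⁻¹ * c, (‖φ‖⁻¹ : ℝ) • A, (suAlgebra V).smul_mem _ hA, ?_⟩
    rw [← h, LinearMap.smul_apply, LinearMap.map_smul_of_tower, smul_smul, mul_comm]
  obtain ⟨e, he, hφe⟩ : ∃ e : V, ‖e‖ = 1 ∧ inner ℂ φ e = 0 := by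
    have : (ℂ ∙ φ)ᗮ ≠ ⊥ := by
      intro hbot
      have h1 := Submodule.finrank_add_finrank_orthogonal (ℂ ∙ φ)
      rw [hbot, finrank_bot, finrank_span_singleton hφ] at h1
      omega
    obtain ⟨u, hu, hu0⟩ := Submodule.exists_mem_ne_zero_of_ne_bot this
    have h0 : ‖u‖ ≠ 0 := norm_ne_zero_iff.mpr hu0
    refine ⟨((‖u‖⁻¹ : ℝ) : ℂ) • u, by rw [norm_smul]; simp [h0], ?_⟩
    rw [inner_smul_right, Submodule.mem_orthogonal_singleton_iff_inner_right.mp hu, mul_zero]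
  have heφ : inner ℂ e φ = 0 := inner_eq_zero_symm.mp hφe
  set α : ℂ := inner ℂ φ v with hα
  set w : V := v - α • φ with hw
  have hφφ : inner ℂ φ φ = (1 : ℂ) := by rw [inner_self_eq_norm_sq_to_K, hn]; simp
  have hee : inner ℂ e e = (1 : ℂ) := by rw [inner_self_eq_norm_sq_to_K, he]; simp
  have hφw : inner ℂ φ w = 0 := by
    rw [hw, inner_sub_right, inner_smul_right, hφφ, mul_one, sub_self]
  have hwφ : inner ℂ w φ = 0 := inner_eq_zero_symm.mp hφw
  let R : V → V → (V →L[ℂ] V) := fun x y => InnerProductSpace.rankOne ℂ x y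
  -- The first two terms send `φ` to `w`, the diagonal one to `i (Im α) φ`; the real part of `α` is
  -- left to the scalar. The vector `e` cancels the trace, which is where dimension two enters.
  refine ⟨α.re, ((R w φ - R φ w + ((α.im : ℂ) * Complex.I) • (R φ φ - R e e) : V →L[ℂ] V) :
    V →ₗ[ℂ] V), ⟨?_, ?_⟩, ?_⟩
  · intro x y
    simp only [R, ContinuousLinearMap.coe_coe, add_apply,
      sub_apply, smul_apply,
      InnerProductSpace.rankOne_apply, inner_add_left, inner_add_right, inner_sub_left,
      inner_sub_right, inner_smul_left, inner_smul_right, inner_conj_symm, map_mul,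
      Complex.conj_I, Complex.conj_ofReal]
    ring
  · have ht : ∀ x y : V, LinearMap.trace ℂ V (R x y : V →ₗ[ℂ] V) = inner ℂ y x :=
      fun x y => InnerProductSpace.trace_rankOne x y
    simp [ht, hφw, hwφ, hn, he]
  · simp only [R, ContinuousLinearMap.coe_coe, add_apply,
      sub_apply, smul_apply,
      InnerProductSpace.rankOne_apply, hφφ, hwφ, heφ, one_smul, zero_smul, sub_zero]
    have : v = w + α • φ := by simp [hw]
    rw [this]
    nth_rewrite 3 [← Complex.re_add_im α]
    rw [add_smul]
    have : (α.re : ℂ) • φ = α.re • φ := by simp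
    rw [this]
    abel

/-- If the generators are skew-adjoint and generate a Lie algebra that contains `su(V)`, the forward
orbit of a unit vector is a neighborhood of one of its points in the sphere. -/
theorem exists_forward_orbit_mem_nhds [CompleteSpace V] {G : Set (V →L[ℂ] V)}
    (hG : ∀ X ∈ G, star X = -X) (hd : 2 ≤ Module.finrank ℂ V)
    (hL : ∀ A ∈ suAlgebra V,
      A ∈ LieSubalgebra.lieSpan ℝ (Module.End ℂ V) {A | LinearMap.toContinuousLinearMap A ∈ G})
    {ψ : V} (hψ : ‖ψ‖ = 1) :
    ∃ g ∈ flowMonoid G, ∀ᶠ y in 𝓝 (g ψ), ‖y‖ = 1 → ∃ h ∈ flowMonoid G, h ψ = y := by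
  obtain ⟨D, W, φ, ⟨E, _, _, _, F, F', hF, hF0, hD, hS⟩, hWD, h1, hGW, hlie⟩ :=
    exists_isAccessible_ge_invariant G ψ
  have hsu : ∀ A ∈ suAlgebra V, LinearMap.toContinuousLinearMap A ∈ W := by
    let T : Module.End ℂ V →ₗ[ℝ] (V →L[ℂ] V) :=
      (LinearMap.toContinuousLinearMap (𝕜 := ℂ) (E := V) (F' := V)).toLinearMap.restrictScalars ℝ
    intro A hA
    refine lieSpan_le_of_lie_mem (W := W.comap T) (fun X hX => hGW hX) ?_ A (hL A hA)
    intro X hX w hw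
    exact hlie _ hX _ hw
  obtain ⟨r, hr, g, hg, hφ⟩ := hS.self_of_nhds
  rw [hF0] at hφ
  have hgψ : ‖g ψ‖ = 1 := by rw [norm_flowMonoid_apply hG hg, hψ]
  have hφ0 : φ ≠ 0 := by
    rw [hφ]; exact smul_ne_zero hr.ne' (norm_ne_zero_iff.mp (by rw [hgψ]; exact one_ne_zero))
  have hsurj : F'.range = ⊤ := by
    refine LinearMap.range_eq_top.mpr fun v => ?_
    obtain ⟨c, A, hA, rfl⟩ := exists_mem_suAlgebra_apply_eq hd hφ0 v
    obtain ⟨e, he⟩ := hD (c • 1 + LinearMap.toContinuousLinearMap A)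
      (hWD (W.add_mem (W.smul_mem c h1) (hsu A hA)))
    exact ⟨e, by simpa using he⟩
  -- Open mapping: near `φ` every vector lies in the forward cone.
  have hnhds := hF.map_nhds_eq_of_surj hsurj
  have hev : ∀ᶠ y in 𝓝 φ, ∃ r : ℝ, 0 < r ∧ ∃ g ∈ flowMonoid G, y = r • g ψ := by
    rw [← hF0, ← hnhds]; exact hS
  refine ⟨g, hg, ?_⟩
  have hc : Tendsto (fun y : V => r • y) (𝓝 (g ψ)) (𝓝 φ) := by
    rw [hφ]; exact (continuous_const_smul r).tendsto _
  filter_upwards [hc.eventually hev] with y ⟨r', hr', h, hh, hy⟩ hy1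
  -- The flows are isometric, so comparing norms identifies the two radial factors.
  have hn := congrArg norm hy
  rw [norm_smul, norm_smul, hy1, norm_flowMonoid_apply hG hh, hψ, mul_one, mul_one,
    Real.norm_of_nonneg hr.le, Real.norm_of_nonneg hr'.le] at hn
  subst hn
  exact ⟨h, hh, (smul_right_injective V hr.ne' hy).symm⟩

/-- Poincaré recurrence for a norm-preserving operator. -/
theorem exists_norm_pow_apply_sub_lt {g : V →L[ℂ] V} (hg : ∀ x, ‖g x‖ = ‖x‖) (x : V) {ε : ℝ}
    (hε : 0 < ε) : ∃ n : ℕ, ‖(g ^ (n + 1)) x - x‖ < ε := by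
  have := FiniteDimensional.proper ℂ V
  have hpow : ∀ (n : ℕ) (y : V), ‖(g ^ n) y‖ = ‖y‖ := by
    intro n
    induction n with
    | zero => simp
    | succ n ih => intro y; rw [pow_succ', mul_apply_eq_comp, hg, ih]
  obtain ⟨y, -, k, hk, hlim⟩ := (isCompact_closedBall (0 : V) ‖x‖).tendsto_subseq
    (x := fun n => (g ^ n) x) (fun n => mem_closedBall_zero_iff.mpr (hpow n x).le)
  -- Two terms of a convergent subsequence of the orbit are close; the isometry `g ^ k N` is
  -- cancelled from both.
  obtain ⟨N, hN⟩ := Metric.cauchySeq_iff'.mp hlim.cauchySeq ε hε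
  have h1 := hN (N + 1) (Nat.le_succ N)
  have hlt := hk (Nat.lt_succ_self N)
  obtain ⟨n, hn⟩ := Nat.exists_eq_add_of_lt hlt
  refine ⟨n, ?_⟩
  rw [Function.comp, Function.comp, dist_eq_norm] at h1
  have e : k (N + 1) = k N + (n + 1) := by rw [← Nat.succ_eq_add_one N, hn]; ring
  rw [e, pow_add, mul_apply_eq_comp, ← map_sub, hpow] at h1
  exact h1

/-- If the generators are skew-adjoint and generate a Lie algebra that contains `su(V)`, the forward
flows act transitively on the unit sphere. -/
theorem exists_flowMonoid_apply_eq [CompleteSpace V] {G : Set (V →L[ℂ] V)}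
    (hG : ∀ X ∈ G, star X = -X) (hd : 2 ≤ Module.finrank ℂ V)
    (hL : ∀ A ∈ suAlgebra V,
      A ∈ LieSubalgebra.lieSpan ℝ (Module.End ℂ V) {A | LinearMap.toContinuousLinearMap A ∈ G})
    {ψ₀ ψ₁ : V} (h₀ : ‖ψ₀‖ = 1) (h₁ : ‖ψ₁‖ = 1) :
    ∃ g ∈ flowMonoid G, g ψ₀ = ψ₁ := by
  let P : V → V → Prop := fun x y => ∃ g ∈ flowMonoid G, g x = y
  have htrans : ∀ {x y z}, P x y → P y z → P x z := by
    rintro x y z ⟨g, hg, rfl⟩ ⟨h, hh, rfl⟩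
    exact ⟨h * g, mul_mem hh hg, rfl⟩
  -- a neighborhood of a point `g ψ` can be moved to every point of the forward orbit of `g ψ`
  -- under the powers of `g`
  have hmove : ∀ {x y}, ‖x‖ = 1 → P x y → (∀ᶠ z in 𝓝 y, ‖z‖ = 1 → P x z) → ∀ {u}, ‖u‖ = 1 →
      (∀ ε > 0, ∃ h ∈ flowMonoid G, ‖h y - u‖ < ε) → ∀ᶠ z in 𝓝 u, ‖z‖ = 1 → P x z := by
    intro x y hx hxy hev u hu happ
    obtain ⟨ε, hε, hball⟩ := Metric.eventually_nhds_iff.mp hev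
    obtain ⟨h, hh, hhy⟩ := happ (ε / 2) (half_pos hε)
    have hiso := norm_flowMonoid_apply hG hh
    have hsurj : Function.Surjective h :=
      LinearMap.injective_iff_surjective.mp
        ((injective_iff_map_eq_zero h.toLinearMap).mpr fun a ha => by
          have : ‖h a‖ = 0 := norm_eq_zero.mpr ha
          rwa [hiso, norm_eq_zero] at this)
    filter_upwards [Metric.ball_mem_nhds u (half_pos hε)] with z hz hz1
    obtain ⟨z, rfl⟩ := hsurj z
    refine htrans (hball ?_ (by rwa [hiso] at hz1)) ⟨h, hh, rfl⟩
    rw [mem_ball_iff_norm] at hz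
    rw [dist_eq_norm, ← hiso, map_sub]
    calc ‖h z - h y‖ = ‖(h z - u) - (h y - u)‖ := by congr 1; abel
      _ ≤ ‖h z - u‖ + ‖h y - u‖ := norm_sub_le _ _
      _ < ε := by linarith
  have hrec : ∀ {x} {g}, g ∈ flowMonoid G → ∀ ε > 0, ∃ h ∈ flowMonoid G, ‖h (g x) - x‖ < ε := by
    intro x g hg ε hε
    obtain ⟨n, hn⟩ := exists_norm_pow_apply_sub_lt (norm_flowMonoid_apply hG hg) x hε
    exact ⟨g ^ n, pow_mem hg n, by rwa [pow_succ, mul_apply_eq_comp] at hn⟩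
  have hself : ∀ {x}, ‖x‖ = 1 → ∀ᶠ z in 𝓝 x, ‖z‖ = 1 → P x z := by
    intro x hx
    obtain ⟨g, hg, hev⟩ := exists_forward_orbit_mem_nhds hG hd hL hx
    exact hmove hx ⟨g, hg, rfl⟩ hev hx (hrec hg)
  have hrefl : ∀ {x}, P x x := ⟨1, one_mem _, rfl⟩
  have hsymm : ∀ {x y}, ‖x‖ = 1 → P x y → P y x := by
    rintro x _ hx ⟨g, hg, rfl⟩
    have hy : ‖g x‖ = 1 := by rw [norm_flowMonoid_apply hG hg, hx]
    -- Points near `g x` are reachable from `g x`; recurrence moves this neighborhood to `x`.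
    exact (hmove hy hrefl (hself hy) hx (hrec hg)).self_of_nhds hx
  have hrank : 1 < Module.rank ℝ V := by
    have h4 : Module.finrank ℝ V = 2 * Module.finrank ℂ V := finrank_real_of_complex V
    have : FiniteDimensional ℝ V := Module.Finite.trans ℂ V
    rw [← Module.finrank_eq_rank]
    exact_mod_cast (by omega : 1 < Module.finrank ℝ V)
  refine (isPreconnected_sphere hrank (0 : V) 1).induction₂ P ?_ ?_ ?_ (by simpa using h₀)
    (by simpa using h₁)
  · intro x hx
    have hx' : ‖x‖ = 1 := by simpa using hx
    filter_upwards [nhdsWithin_le_nhds (hself hx'), self_mem_nhdsWithin] with y hy hys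
    exact hy (by simpa using hys)
  · intro x y z _ _ _ hxy hyz
    exact htrans hxy hyz
  · intro x y hx _ hxy
    exact hsymm (by simpa using hx) hxy

end Transitivity

/-! ### Gluing of trajectories -/

/-- Two Lipschitz maps that agree at a point can be glued there. -/
theorem LipschitzWith.piecewise_of_eq {E : Type*} [PseudoMetricSpace E] {f g : ℝ → E} {κ κ' : NNReal}
    (hf : LipschitzWith κ f) (hg : LipschitzWith κ' g) {T : ℝ} (h : f T = g T) :
    LipschitzWith (κ + κ') (fun t => if t ≤ T then f t else g t) := by
  refine LipschitzWith.of_dist_le_mul fun x y => ?_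
  wlog hxy : x ≤ y generalizing x y
  · rw [dist_comm, dist_comm x]; exact this y x (le_of_not_ge hxy)
  push_cast
  rw [add_mul]
  have p1 : 0 ≤ (κ : ℝ) * dist x y := by positivity
  have p2 : 0 ≤ (κ' : ℝ) * dist x y := by positivity
  by_cases hy : y ≤ T
  · rw [if_pos hy, if_pos (hxy.trans hy)]
    linarith [hf.dist_le_mul x y]
  · by_cases hx : x ≤ T
    · rw [if_pos hx, if_neg hy]
      have hyT : T ≤ y := (not_le.mp hy).le
      have d1 : dist x T ≤ dist x y := by
        rw [Real.dist_eq, Real.dist_eq, abs_sub_comm, abs_sub_comm x, abs_of_nonneg (by linarith),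
          abs_of_nonneg (by linarith)]; linarith
      have d2 : dist T y ≤ dist x y := by
        rw [Real.dist_eq, Real.dist_eq, abs_sub_comm, abs_sub_comm x, abs_of_nonneg (by linarith),
          abs_of_nonneg (by linarith)]; linarith
      calc dist (f x) (g y) ≤ dist (f x) (f T) + dist (g T) (g y) := by
            rw [← h]; exact dist_triangle _ _ _
        _ ≤ κ * dist x T + κ' * dist T y := add_le_add (hf.dist_le_mul _ _) (hg.dist_le_mul _ _)
        _ ≤ _ := by gcongr
    · rw [if_neg hy, if_neg hx]
      linarith [hg.dist_le_mul x y]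

/-! ### From flows to trajectories of the controlled equation -/

section Reachability

variable {H : Type*} [NormedAddCommGroup H] [InnerProductSpace ℂ H]

/-- Reachability by a Lipschitz trajectory. -/
def IsLipschitzReachable (B C : Module.End ℂ H) (x y : H) : Prop :=
  ∃ (T : ℝ) (s : ℝ → ℝ) (ψ : ℝ → H) (κ : NNReal), 0 ≤ T ∧ Measurable s ∧
    (∀ t, s t ∈ Icc (0 : ℝ) 1) ∧ LipschitzWith κ ψ ∧
    (∀ᵐ t : ℝ, t ∈ Icc 0 T →
      HasDerivAt ψ ((-Complex.I) • scheduleHamiltonian B C (s t) (ψ t)) t) ∧ ψ 0 = x ∧ ψ T = y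

theorem IsLipschitzReachable.isReachable {B C : Module.End ℂ H} {x y : H}
    (h : IsLipschitzReachable B C x y) : IsReachable B C x y := by
  obtain ⟨T, s, ψ, κ, hT, hs, hs1, hψ, hd, h0, h1⟩ := h
  exact ⟨T, s, ψ, hT, ⟨hs, fun t _ => hs1 t⟩,
    ⟨hψ.lipschitzOnWith.absolutelyContinuousOnInterval, hd⟩, h0, h1⟩

theorem IsLipschitzReachable.refl (B C : Module.End ℂ H) (x : H) :
    IsLipschitzReachable B C x x := by
  refine ⟨0, fun _ => 0, fun _ => x, 0, le_rfl, measurable_const, by simp,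
    LipschitzWith.const x, ?_, rfl, rfl⟩
  filter_upwards [Measure.ae_ne volume (0 : ℝ)] with t ht htI
  exact absurd (le_antisymm htI.2 htI.1) ht

/-- A trajectory can be continued by a trajectory of a constant schedule. -/
theorem IsLipschitzReachable.append {B C : Module.End ℂ H} {x y : H}
    (h : IsLipschitzReachable B C x y) {σ : ℝ} (hσ : σ ∈ Icc (0 : ℝ) 1) {f : ℝ → H} {κ' : NNReal}
    (hf : LipschitzWith κ' f) (hf0 : f 0 = y)
    (hfd : ∀ t, HasDerivAt f ((-Complex.I) • scheduleHamiltonian B C σ (f t)) t) {τ : ℝ}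
    (hτ : 0 ≤ τ) : IsLipschitzReachable B C x (f τ) := by
  obtain ⟨T, s, ψ, κ, hT, hs, hs1, hψ, hd, h0, h1⟩ := h
  have hshift : LipschitzWith κ' (fun t => f (t - T)) := by
    refine LipschitzWith.of_dist_le_mul fun a b => ?_
    simpa using hf.dist_le_mul (a - T) (b - T)
  have hglue : ψ T = (fun t => f (t - T)) T := by simp [h1, hf0]
  refine ⟨T + τ, fun t => if t ≤ T then s t else σ, fun t => if t ≤ T then ψ t else f (t - T), _,
    by positivity, Measurable.ite measurableSet_Iic hs measurable_const, ?_,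
    hψ.piecewise_of_eq hshift hglue, ?_, by simp [hT, h0], ?_⟩
  · intro t
    by_cases ht : t ≤ T
    · simpa only [if_pos ht] using hs1 t
    · simpa only [if_neg ht] using hσ
  -- The glued curve may fail to be differentiable at the switching time, a null set.
  · filter_upwards [hd, Measure.ae_ne volume T] with t ht htT htI
    rcases lt_or_gt_of_ne htT with hlt | hgt
    · simp only [if_pos hlt.le]
      refine (ht ⟨htI.1, hlt.le⟩).congr_of_eventuallyEq ?_
      filter_upwards [gt_mem_nhds hlt] with u hu
      rw [if_pos hu.le]
    · simp only [if_neg (not_le.mpr hgt)]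
      have := (hfd (t - T)).comp_sub_const t T
      refine this.congr_of_eventuallyEq ?_
      filter_upwards [lt_mem_nhds hgt] with u hu
      rw [if_neg (not_le.mpr hu)]
  · rcases hτ.eq_or_lt with rfl | hpos
    · simp [h1, hf0]
    · have : ¬ T + τ ≤ T := by linarith
      simp [hpos]

/-- On an invariant subspace, the forward flows of generators that come from constant schedules only
lead to reachable vectors. -/
theorem isLipschitzReachable_flowMonoid {B C : Module.End ℂ H} {K : Submodule ℂ H}
    [CompleteSpace K] {G : Set (K →L[ℂ] K)} (hG : ∀ X ∈ G, star X = -X)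
    (hGs : ∀ X ∈ G, ∃ σ ∈ Icc (0 : ℝ) 1, ∀ x : K,
      ((X x : K) : H) = (-Complex.I) • scheduleHamiltonian B C σ x)
    {g : K →L[ℂ] K} (hg : g ∈ flowMonoid G) (x : K) : IsLipschitzReachable B C x (g x : K) := by
  induction hg using Submonoid.closure_induction_left with
  | one => exact IsLipschitzReachable.refl B C x
  | mul_left u hu g hg ih =>
    obtain ⟨X, hX, τ, hτ, rfl⟩ := hu
    obtain ⟨σ, hσ, hXσ⟩ := hGs X hX
    set y := g x
    have hder : ∀ t : ℝ, HasDerivAt (fun t : ℝ => exp (t • X) y) (X (exp (t • X) y)) t := by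
      intro t
      let R : (K →L[ℂ] K) →L[ℝ] K :=
        (ContinuousLinearMap.apply ℂ K y).restrictScalars ℝ
      exact R.hasFDerivAt.comp_hasDerivAt t (hasDerivAt_exp_smul_const' (𝕂 := ℝ) X t)
    have hderH : ∀ t : ℝ, HasDerivAt (fun t : ℝ => ((exp (t • X) y : K) : H))
        ((X (exp (t • X) y) : K) : H) t := fun t =>
      (K.subtypeL.restrictScalars ℝ).hasFDerivAt.comp_hasDerivAt t (hder t)
    have hn : ∀ t : ℝ, ‖exp (t • X) y‖ = ‖y‖ := by
      intro t
      rcases le_total 0 t with ht | ht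
      · exact norm_flowMonoid_apply hG (exp_mem_flowMonoid hX ht) y
      · have := norm_flowMonoid_apply hG (exp_mem_flowMonoid hX (neg_nonneg.mpr ht)) (exp (t • X) y)
        rw [neg_smul, ← mul_apply_eq_comp, exp_neg_mul_exp_self] at this
        exact this.symm
    have hlip : LipschitzWith (‖X‖₊ * ‖y‖₊) (fun t : ℝ => ((exp (t • X) y : K) : H)) := by
      refine lipschitzWith_of_nnnorm_deriv_le (𝕜 := ℝ) (fun t => (hderH t).differentiableAt) fun t => ?_
      rw [(hderH t).deriv]
      have h1 := X.le_opNorm (exp (t • X) y)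
      rw [hn] at h1
      exact h1
    exact ih.append hσ hlip (by simp [y]) (fun t => by rw [← hXσ]; exact hderH t) hτ

/-- The elements of the dynamical Lie algebra restrict to elements of the Lie algebra generated by
the restrictions of the generators. -/
theorem exists_mem_lieSpan_restrict {K : Submodule ℂ H} {s : Set (Module.End ℂ H)}
    {s' : Set (Module.End ℂ K)} (hs : ∀ X ∈ s, ∃ A ∈ s', ∀ x : K, X (x : H) = (A x : H)) :
    ∀ X ∈ LieSubalgebra.lieSpan ℝ (Module.End ℂ H) s,
      ∃ A ∈ LieSubalgebra.lieSpan ℝ (Module.End ℂ K) s', ∀ x : K, X (x : H) = (A x : H) := by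
  intro X hX
  induction hX using LieSubalgebra.lieSpan_induction with
  | mem X hX =>
    obtain ⟨A, hA, h⟩ := hs X hX
    exact ⟨A, LieSubalgebra.subset_lieSpan hA, h⟩
  | zero => exact ⟨0, LieSubalgebra.zero_mem _, by simp⟩
  | add X Y _ _ hX hY =>
    obtain ⟨A, hA, h⟩ := hX
    obtain ⟨A', hA', h'⟩ := hY
    exact ⟨A + A', LieSubalgebra.add_mem _ hA hA', fun x => by simp [h, h']⟩
  | smul c X _ hX =>
    obtain ⟨A, hA, h⟩ := hX
    exact ⟨c • A, LieSubalgebra.smul_mem _ c hA, fun x => by simp [h]⟩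
  | lie X Y _ _ hX hY =>
    obtain ⟨A, hA, h⟩ := hX
    obtain ⟨A', hA', h'⟩ := hY
    exact ⟨⁅A, A'⁆, LieSubalgebra.lie_mem _ hA hA', fun x => by simp [Ring.lie_def, h, h']⟩

/-- If the block of the dynamical Lie algebra on an invariant subspace of dimension at least two
contains `su`, all unit vectors of the subspace are reachable from one another. -/
theorem isReachable_of_suAlgebra_subset [FiniteDimensional ℂ H] {B C : Module.End ℂ H} (hB : B.IsSymmetric)
    (hC : C.IsSymmetric) {K : Submodule ℂ H} (hBK : ∀ x ∈ K, B x ∈ K) (hCK : ∀ x ∈ K, C x ∈ K)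
    (hd : 2 ≤ Module.finrank ℂ K)
    (hsu : (suAlgebra K : Set (Module.End ℂ K)) ⊆ blockRestriction (dynamicalLieAlgebra B C) K)
    {ψ₀ ψ₁ : H} (hψ₀ : ψ₀ ∈ K) (hψ₁ : ψ₁ ∈ K) (h₀ : ‖ψ₀‖ = 1) (h₁ : ‖ψ₁‖ = 1) :
    IsReachable B C ψ₀ ψ₁ := by
  have : CompleteSpace K := FiniteDimensional.complete ℂ K
  have skew : ∀ {A : Module.End ℂ H} (hA : A.IsSymmetric) (hAK : ∀ x ∈ K, A x ∈ K),
      star (LinearMap.toContinuousLinearMap ((-Complex.I) • A.restrict hAK)) =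
        -LinearMap.toContinuousLinearMap ((-Complex.I) • A.restrict hAK) := by
    intro A hA hAK
    refine ContinuousLinearMap.ext fun x => ext_inner_right ℂ fun y => ?_
    rw [ContinuousLinearMap.star_eq_adjoint, ContinuousLinearMap.adjoint_inner_left]
    have := hA x y
    simp [inner_smul_right, inner_smul_left, this]
  let b : Module.End ℂ K := (-Complex.I) • B.restrict hBK
  let c : Module.End ℂ K := (-Complex.I) • C.restrict hCK
  let G : Set (K →L[ℂ] K) :=
    {LinearMap.toContinuousLinearMap b, LinearMap.toContinuousLinearMap c}
  have hG : ∀ X ∈ G, star X = -X := by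
    rintro X (rfl | rfl)
    · exact skew hB hBK
    · exact skew hC hCK
  have hGs : ∀ X ∈ G, ∃ σ ∈ Icc (0 : ℝ) 1, ∀ x : K,
      ((X x : K) : H) = (-Complex.I) • scheduleHamiltonian B C σ x := by
    rintro X (rfl | rfl)
    · exact ⟨1, by simp, fun x => by simp [b, scheduleHamiltonian]⟩
    · exact ⟨0, by simp, fun x => by simp [c, scheduleHamiltonian]⟩
  have hL : ∀ A ∈ suAlgebra K, A ∈ LieSubalgebra.lieSpan ℝ (Module.End ℂ K)
      {A | LinearMap.toContinuousLinearMap A ∈ G} := by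
    intro A hA
    obtain ⟨X, hX, hXA⟩ := hsu hA
    obtain ⟨A', hA', hXA'⟩ := exists_mem_lieSpan_restrict (K := K)
      (s' := {A | LinearMap.toContinuousLinearMap A ∈ G}) (by
        rintro X (rfl | rfl)
        · exact ⟨b, Or.inl rfl, fun x => by simp [b]⟩
        · exact ⟨c, Or.inr rfl, fun x => by simp [c]⟩) X hX
    have : A = A' := LinearMap.ext fun x => Subtype.ext (by rw [← hXA, hXA'])
    exact this ▸ hA'
  obtain ⟨g, hg, hgψ⟩ := exists_flowMonoid_apply_eq hG hd hL (ψ₀ := (⟨ψ₀, hψ₀⟩ : K))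
    (ψ₁ := (⟨ψ₁, hψ₁⟩ : K)) h₀ h₁
  have := (isLipschitzReachable_flowMonoid hG hGs hg ⟨ψ₀, hψ₀⟩).isReachable
  rwa [hgψ] at this

end Reachability

/-! ### Block structure and reachability -/

theorem proposition1 {H : Type*} [NormedAddCommGroup H] [InnerProductSpace ℂ H]
    [FiniteDimensional ℂ H] (B C P₀ : Module.End ℂ H)
    (hB : B.IsSymmetric) (hC : C.IsSymmetric) (hP₀ : P₀.IsSymmetricProjection)
    (hBP : ⁅B, P₀⁆ = 0) (hCP : ⁅C, P₀⁆ = 0) :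
    -- the orthogonal decomposition of the Hilbert space
    (IsCompl (LinearMap.range P₀) (LinearMap.ker P₀) ∧
      LinearMap.range P₀ ⟂ LinearMap.ker P₀) ∧
    -- the Lie algebra generated by `B` and `C` has the same block structure
    (∀ X ∈ dynamicalLieAlgebra B C,
      (∀ x ∈ LinearMap.range P₀, X x ∈ LinearMap.range P₀) ∧
      (∀ x ∈ LinearMap.ker P₀, X x ∈ LinearMap.ker P₀)) ∧
    -- if its block on the range of `P₀` contains `su(d₀)`, every state of the range is reachable:
    -- as a state, and as a vector as soon as `d₀ ≥ 2`
    ((suAlgebra (LinearMap.range P₀) : Set (Module.End ℂ (LinearMap.range P₀))) ⊆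
        blockRestriction (dynamicalLieAlgebra B C) (LinearMap.range P₀) →
      ∀ ψ₀ ∈ LinearMap.range P₀, ∀ ψ₁ ∈ LinearMap.range P₀, ‖ψ₀‖ = 1 → ‖ψ₁‖ = 1 →
        (∃ c : ℂ, ‖c‖ = 1 ∧ IsReachable B C ψ₀ (c • ψ₁)) ∧
        (2 ≤ Module.finrank ℂ (LinearMap.range P₀) → IsReachable B C ψ₀ ψ₁)) := by
  have inv : ∀ X : Module.End ℂ H, ⁅X, P₀⁆ = 0 → (∀ x ∈ LinearMap.range P₀, X x ∈ LinearMap.range P₀) ∧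
      (∀ x ∈ LinearMap.ker P₀, X x ∈ LinearMap.ker P₀) := by
    intro X hX
    have hc : ∀ x, X (P₀ x) = P₀ (X x) := fun x => by
      rw [Ring.lie_def, sub_eq_zero] at hX
      exact congrArg (fun T : Module.End ℂ H => T x) hX
    refine ⟨?_, fun x hx => ?_⟩
    · rintro _ ⟨x, rfl⟩
      exact ⟨X x, (hc x).symm⟩
    · rw [LinearMap.mem_ker] at hx ⊢
      rw [← hc, hx, map_zero]
  refine ⟨⟨?_, ?_⟩, ?_, ?_⟩
  · exact (LinearMap.IsIdempotentElem.isCompl hP₀.isIdempotentElem)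
  · rw [Submodule.isOrtho_iff_inner_eq]
    rintro _ ⟨x, rfl⟩ y hy
    rw [hP₀.isSymmetric, LinearMap.mem_ker.mp hy, inner_zero_right]
  · intro X hX
    refine inv X ?_
    induction hX using LieSubalgebra.lieSpan_induction with
    | mem X hX => rcases hX with rfl | rfl <;> simp [hBP, hCP]
    | zero => simp
    | add X Y _ _ hX hY => rw [add_lie, hX, hY, add_zero]
    | smul c X _ hX => rw [smul_lie, hX, smul_zero]
    | lie X Y _ _ hX hY => rw [lie_lie, hX, hY, lie_zero, lie_zero, sub_zero]
  · intro hsu ψ₀ hψ₀ ψ₁ hψ₁ h₀ h₁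
    have hreach : 2 ≤ Module.finrank ℂ (LinearMap.range P₀) → IsReachable B C ψ₀ ψ₁ := fun hd =>
      isReachable_of_suAlgebra_subset hB hC (inv B hBP).1 (inv C hCP).1 hd hsu hψ₀ hψ₁ h₀ h₁
    refine ⟨?_, hreach⟩
    by_cases hd : 2 ≤ Module.finrank ℂ (LinearMap.range P₀)
    · exact ⟨1, norm_one, by rw [one_smul]; exact hreach hd⟩
    -- Here both vectors lie on one complex line, and `c` is chosen so that `c • ψ₁` is `ψ₀` itself.
    · obtain ⟨v, hv⟩ := finrank_le_one_iff.mp (show Module.finrank ℂ (LinearMap.range P₀) ≤ 1 by omega)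
      obtain ⟨c₀, hc₀⟩ := hv ⟨ψ₀, hψ₀⟩
      obtain ⟨c₁, hc₁⟩ := hv ⟨ψ₁, hψ₁⟩
      have e₀ : c₀ • (v : H) = ψ₀ := congrArg Subtype.val hc₀
      have e₁ : c₁ • (v : H) = ψ₁ := congrArg Subtype.val hc₁
      have hne : c₁ ≠ 0 := by rintro rfl; simp [← e₁] at h₁
      have h : (c₀ / c₁) • ψ₁ = ψ₀ := by rw [← e₁, smul_smul, div_mul_cancel₀ _ hne, e₀]
      refine ⟨c₀ / c₁, ?_, ?_⟩
      · rw [← h, norm_smul, h₁, mul_one] at h₀; exact h₀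
      · rw [h]; exact (IsLipschitzReachable.refl B C ψ₀).isReachable
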